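/- Consider a buffer with a capacity of $B$ bytes. Every arriving packet $p$ has a length $\ell(p)\in\{1,\dots,L\}$ (in bytes) and requires $r(p)\in\{1,\dots,k\}$ processing cycles. Time is slotted. In each slot, first the stored packets with no residual processing cycles are transmitted (they leave the buffer); then packets arrive one after another, and arriving as well as stored packets may be dropped (a dropped packet is lost), where the packets kept must have overall length at most $B$; finally at most one stored packet is processed for one cycle. The throughput is the overall length of all transmitted packets. Let $\mathrm{PO}$ be the following push-out policy with longest-packet-first (LP) priority: the buffer is ordered by non-increasing packet length, packets of equal length in the order of their arrival; an arriving packet is accepted at its place in this order, and then, while the last packet in the buffer starts above position $B-2L+1$ (byte positions are counted from $1$), that last packet is dropped; in every slot in which the buffer is not empty, the first packet in the buffer is processed. Theorem. For all $k$ and $L$ there is a $B_0=B_0(k,L)$ such that for every $B\ge B_0$ the policy $\mathrm{PO}$ is $(k+3)$-competitive: for every arrival sequence, the throughput of an optimal offline solution with the same buffer capacity $B$ is at most $k+3$ times the throughput of $\mathrm{PO}$. -/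

import Mathlib

open scoped ENNReal

namespace PacketQueue

/-- An arrival sequence in slotted time. In slot `t` exactly `count t` packets arrive, one after
another; the packet with identity `(t, i)`, `i < count t`, is the `i`-th of them. Every packet has a
length in `{1, …, L}` (bytes) and requires a number of processing cycles in `{1, …, k}`. (The values
of `length` and `work` at pairs that are not packets are never used.) -/
structure ArrivalSequence (k L : ℕ) where
  count : ℕ → ℕ
  length : ℕ × ℕ → ℕ
  work : ℕ × ℕ → ℕ
  length_bounds : ∀ p : ℕ × ℕ, p.2 < count p.1 → 1 ≤ length p ∧ length p ≤ L
  work_bounds : ∀ p : ℕ × ℕ, p.2 < count p.1 → 1 ≤ work p ∧ work p ≤ k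

/-- The state of a queue at the beginning of a slot: the stored packets (head of line first, where an
order matters) and the number of residual processing cycles of every packet. -/
structure QueueState where
  buffer : List (ℕ × ℕ)
  residual : ℕ × ℕ → ℕ

namespace QueueState

/-- The packets that leave the queue in the transmission phase. -/
def leaving (s : QueueState) : List (ℕ × ℕ) :=
  s.buffer.filter fun p => s.residual p = 0

/-- The packets that are still stored after the transmission phase. -/
def remaining (s : QueueState) : List (ℕ × ℕ) :=
  s.buffer.filter fun p => 0 < s.residual p

end QueueState

/-- The residual cycles after packet `p` has been processed for one slot. -/
def processPacket (residual : ℕ × ℕ → ℕ) (p : ℕ × ℕ) : ℕ × ℕ → ℕ :=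
  Function.update residual p (residual p - 1)

namespace ArrivalSequence

variable {k L : ℕ}

/-- The packets that arrive in slot `t`, in the order of their arrival. -/
def arrivals (σ : ArrivalSequence k L) (t : ℕ) : List (ℕ × ℕ) :=
  (List.range (σ.count t)).map fun i => (t, i)

/-- The overall length of a list of packets. -/
def totalLength (σ : ArrivalSequence k L) (l : List (ℕ × ℕ)) : ℕ :=
  (l.map σ.length).sum

/-- The queue is empty at first and no packet has been processed. -/
def initialState (σ : ArrivalSequence k L) : QueueState where
  buffer := []
  residual := σ.work

/-- The throughput of a run (given by its state at the beginning of each slot): the overall length of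
all packets that are transmitted at any time. -/
noncomputable def throughput (σ : ArrivalSequence k L) (S : ℕ → QueueState) : ℝ≥0∞ :=
  ∑' t, (σ.totalLength (S t).leaving : ℝ≥0∞)

/-- What any policy, clairvoyant or not, may do in slot `t` with a buffer of `B` bytes. The packets
without residual work leave; among the other stored packets and the packets that arrive in the slot,
an arbitrary set of overall length at most `B` is kept, and the rest is lost; then at most one of the
kept packets is processed for one cycle. -/
def IsStep (σ : ArrivalSequence k L) (B t : ℕ) (s s' : QueueState) : Prop :=
  s'.buffer.Nodup ∧
  s'.buffer ⊆ s.remaining ++ σ.arrivals t ∧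
  σ.totalLength s'.buffer ≤ B ∧
  (s'.residual = s.residual ∨ ∃ p ∈ s'.buffer, s'.residual = processPacket s.residual p)

/-- The feasible (possibly offline) schedules for the arrival sequence `σ`. -/
def IsSchedule (σ : ArrivalSequence k L) (B : ℕ) (S : ℕ → QueueState) : Prop :=
  S 0 = σ.initialState ∧ ∀ t, σ.IsStep B t (S t) (S (t + 1))

/-- The throughput of an optimal offline solution. -/
noncomputable def optThroughput (σ : ArrivalSequence k L) (B : ℕ) : ℝ≥0∞ :=
  ⨆ (S : ℕ → QueueState) (_ : σ.IsSchedule B S), σ.throughput S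

/-- While the last packet of the buffer starts above position `B - 2 * L + 1`, drop it. Positions are
counted in bytes from `1`, so the last packet starts at position `1` plus the overall length of the
packets in front of it. -/
def pushOut (σ : ArrivalSequence k L) (B : ℕ) (buf : List (ℕ × ℕ)) : List (ℕ × ℕ) :=
  if buf ≠ [] ∧ B + 1 < (σ.totalLength buf.dropLast + 1) + 2 * L then
    pushOut σ B buf.dropLast
  else buf
termination_by buf.length
decreasing_by
  rename_i h
  have := List.length_pos_of_ne_nil h.1
  simp only [List.length_dropLast]
  omega

/-- The push-out policy with longest-packet-first priority, on the arrival of `p`: accept `p`, at its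
place in the order of non-increasing length and behind the stored packets of the same length, and
then push out packets from the end of the buffer. -/
def lpAccept (σ : ArrivalSequence k L) (B : ℕ) (buf : List (ℕ × ℕ)) (p : ℕ × ℕ) : List (ℕ × ℕ) :=
  σ.pushOut B (buf.orderedInsert (fun a b => σ.length b < σ.length a) p)

/-- One slot of the push-out policy with longest-packet-first priority: transmission, arrivals one by
one, and one cycle of processing for the head-of-line packet, which is a longest packet. -/
def lpStep (σ : ArrivalSequence k L) (B t : ℕ) (s : QueueState) : QueueState :=
  let buf := (σ.arrivals t).foldl (σ.lpAccept B) s.remaining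
  { buffer := buf
    residual := match buf with
      | [] => s.residual
      | p :: _ => processPacket s.residual p }

/-- The run of the push-out policy with longest-packet-first priority. -/
def lpRun (σ : ArrivalSequence k L) (B : ℕ) : ℕ → QueueState
  | 0 => σ.initialState
  | t + 1 => σ.lpStep B t (lpRun σ B t)

end ArrivalSequence

/-- A policy, given by its run on each arrival sequence, is `α`-competitive with buffer size `B` if
on every arrival sequence the throughput of an optimal offline solution is at most `α` times its
throughput. -/
def IsCompetitive {k L : ℕ} (B : ℕ) (policy : ArrivalSequence k L → ℕ → QueueState)
    (α : ℝ≥0∞) : Prop :=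
  ∀ σ : ArrivalSequence k L, σ.optThroughput B ≤ α * σ.throughput (policy σ)

end PacketQueue

/-! Each slot compares the packet `g` that the schedule transmits (at most one) with the head of
line `p` of the policy. If `g` is no longer than `p`, its bytes are charged to the cycle spent on
`p`. Cycles on packets that the policy transmits cost at most `k * X`, where `X` is its throughput
so far. If `g` is longer than `p`, either the policy has transmitted `g` too, which costs at most
`X` overall, or it has lost `g`. What remains is to pay for lost packets and for cycles wasted on
packets pushed out, with a budget of `2 * X`.

This budget is kept for every length level `x` (`Ledger.level_le`): settled debt, plus the
schedule's stored bytes of length at least `x` that the policy lost, plus waste, is at most `2 * (X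
+ R)`, with `R` the policy's stored bytes of length at least `x`. A loss that matters at level `x`
leaves more than `B - 2 * L` such bytes in the buffer (`pushOut_spec`). Twice this exceeds the
schedule's `B` bytes plus the waste, which is at most `k * (L + 1) ^ 2`; hence the choice of `B₀`
(`Ledger.arrive`). Waste stays bounded because what is owed for length `y` is settled before an
unprocessed packet of length `y` is started (`Ledger.settle`).

When the policy's buffer is empty, level `0` gives debt plus waste at most `2 * X`, so the total is
`(k + 3) * X`. If the buffer is empty only finitely often, processing never ceases and the policy's
throughput is infinite. -/

namespace PacketQueue

/-! ### Order and fullness of the push-out buffer. -/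

namespace ArrivalSequence

variable {k L : ℕ}

/-- In a buffer of the policy, lengths do not increase, and only the first packet of each length may
have been processed. -/
def Precedes (σ : ArrivalSequence k L) (res : ℕ × ℕ → ℕ) (a b : ℕ × ℕ) : Prop :=
  σ.length b ≤ σ.length a ∧ (σ.length b = σ.length a → σ.work b ≤ res b)

/-- The packets of length at least `x` nearly fill the buffer. -/
def Full (σ : ArrivalSequence k L) (B : ℕ) (l : List (ℕ × ℕ)) (x : ℕ) : Prop :=
  B < σ.totalLength (l.filter fun a => x ≤ σ.length a) + 2 * L

/-- The levels at which the buffer is full when `q` is pushed out. -/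
def Witnesses (σ : ArrivalSequence k L) (res : ℕ × ℕ → ℕ) (q : ℕ × ℕ) (x : ℕ) : Prop :=
  x ≤ σ.length q ∨ (x ≤ σ.length q + 1 ∧ res q < σ.work q)

variable (σ : ArrivalSequence k L) (B : ℕ) (res : ℕ × ℕ → ℕ)

theorem totalLength_eq_sum {l : List (ℕ × ℕ)} (h : l.Nodup) :
    σ.totalLength l = ∑ a ∈ l.toFinset, σ.length a := by
  rw [totalLength, List.sum_toFinset _ h]

theorem full_iff {l : List (ℕ × ℕ)} (h : l.Nodup) (x : ℕ) :
    σ.Full B l x ↔ B < ∑ a ∈ l.toFinset with x ≤ σ.length a, σ.length a + 2 * L := by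
  rw [Full, totalLength_eq_sum σ (h.filter _), List.toFinset_filter]
  simp

theorem pairwise_orderedInsert {p : ℕ × ℕ} (hp : σ.work p ≤ res p) {l : List (ℕ × ℕ)}
    (hl : l.Pairwise (σ.Precedes res)) :
    (l.orderedInsert (fun a b => σ.length b < σ.length a) p).Pairwise (σ.Precedes res) := by
  induction l with
  | nil => simp
  | cons b l ih =>
    rw [List.pairwise_cons] at hl
    rw [List.orderedInsert_cons]
    split_ifs with h
    · refine List.pairwise_cons.2 ⟨fun c hc => ?_, List.pairwise_cons.2 hl⟩
      have : σ.length c ≤ σ.length b := by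
        rcases List.mem_cons.1 hc with rfl | hc
        · exact le_rfl
        · exact (hl.1 c hc).1
      exact ⟨by omega, fun h' => by omega⟩
    · refine List.pairwise_cons.2 ⟨fun c hc => ?_, ih hl.2⟩
      rcases List.mem_cons.1 ((List.perm_orderedInsert _ p l).mem_iff.1 hc) with rfl | hc
      · exact ⟨by omega, fun _ => hp⟩
      · exact hl.1 c hc

theorem full_orderedInsert (p : ℕ × ℕ) {l : List (ℕ × ℕ)} {x : ℕ} (h : σ.Full B l x) :
    σ.Full B (l.orderedInsert (fun a b => σ.length b < σ.length a) p) x := by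
  have h1 := ((((List.perm_orderedInsert (fun a b => σ.length b < σ.length a) p l).filter
    fun a => decide (x ≤ σ.length a)).map σ.length).sum_eq)
  have h2 : ((l.filter fun a => x ≤ σ.length a).map σ.length).sum ≤
      (((p :: l).filter fun a => x ≤ σ.length a).map σ.length).sum := by
    rw [List.filter_cons]
    split_ifs <;> simp
  simp only [Full, totalLength] at h ⊢
  omega

theorem full_of_forall_le {l : List (ℕ × ℕ)} {x : ℕ} (h : ∀ a ∈ l, x ≤ σ.length a)
    (hB : B < σ.totalLength l + 2 * L) : σ.Full B l x := by
  rwa [Full, List.filter_eq_self.2 (by simpa using h)]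

/-- A packet is dropped only when the packets in front of it exceed `B - 2 * L` bytes, and these are
at least as long. If it was partly processed, they are strictly longer, since only the first packet
of a length can be processed; this gives fullness one level higher. -/
theorem pushOut_spec (l : List (ℕ × ℕ)) (hl : l.Pairwise (σ.Precedes res)) :
    (σ.pushOut B l).Sublist l ∧ (∀ x, σ.Full B l x → σ.Full B (σ.pushOut B l) x) ∧
      ∀ q ∈ l, q ∉ σ.pushOut B l → ∀ x, σ.Witnesses res q x → σ.Full B (σ.pushOut B l) x := by
  induction l using List.reverseRecOn with
  | nil =>
    rw [pushOut]
    simp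
  | append_singleton l z ih =>
    rw [pushOut]
    have hl' := List.pairwise_append.1 hl
    have hz : ∀ a ∈ l, σ.Precedes res a z := fun a ha => hl'.2.2 a ha z (by simp)
    split_ifs with h
    · rw [List.dropLast_concat] at h ⊢
      obtain ⟨h1, h2, h3⟩ := ih hl'.1
      have hB : B < σ.totalLength l + 2 * L := by omega
      refine ⟨h1.trans (List.sublist_append_left _ _), fun x hx => h2 x ?_, fun q hq hq' x hx => ?_⟩
      -- If `z` counts at level `x`, so does everything in front of it, which suffices by itself;
      -- otherwise dropping `z` leaves level `x` unchanged.
      · by_cases hxz : x ≤ σ.length z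
        · exact σ.full_of_forall_le B (fun a ha => hxz.trans (hz a ha).1) hB
        · simpa [Full, List.filter_append, List.filter_cons, hxz] using hx
      · rcases List.mem_append.1 hq with hq | hq
        · exact h3 q hq hq' x hx
        · obtain rfl : q = z := by simpa using hq
          refine h2 x (σ.full_of_forall_le B (fun a ha => ?_) hB)
          obtain ⟨ha1, ha2⟩ := hz a ha
          rcases hx with hx | ⟨hx, hq⟩
          · omega
          · by_contra hlt
            have := ha2 (by omega)
            omega
    · exact ⟨List.Sublist.refl _, fun _ h => h, fun q hq hq' => absurd hq hq'⟩

theorem foldl_lpAccept_spec (as : List (ℕ × ℕ)) (has : ∀ p ∈ as, σ.work p ≤ res p)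
    (l : List (ℕ × ℕ)) (hl : l.Pairwise (σ.Precedes res)) (hn : (l ++ as).Nodup) :
    (as.foldl (σ.lpAccept B) l).Nodup ∧
    (as.foldl (σ.lpAccept B) l).Pairwise (σ.Precedes res) ∧
    as.foldl (σ.lpAccept B) l ⊆ l ++ as ∧
    (∀ x, σ.Full B l x → σ.Full B (as.foldl (σ.lpAccept B) l) x) ∧
    ∀ q ∈ l ++ as, q ∉ as.foldl (σ.lpAccept B) l → ∀ x, σ.Witnesses res q x →
      σ.Full B (as.foldl (σ.lpAccept B) l) x := by
  induction as generalizing l with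
  | nil =>
    refine ⟨by simpa using hn, hl, by simp, fun _ h => h, fun q hq hq' => ?_⟩
    exact absurd (by simpa using hq) hq'
  | cons p as ih =>
    rw [List.foldl_cons]
    have hi := σ.pairwise_orderedInsert res (has p (by simp)) hl
    have hperm := List.perm_orderedInsert (fun a b => σ.length b < σ.length a) p l
    obtain ⟨h1, h2, h3⟩ := σ.pushOut_spec B res _ hi
    change (σ.lpAccept B l p).Sublist _ at h1
    change ∀ x, _ → σ.Full B (σ.lpAccept B l p) x at h2
    change ∀ q ∈ _, q ∉ σ.lpAccept B l p → ∀ x, _ → σ.Full B (σ.lpAccept B l p) x at h3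
    have hn' : (l.orderedInsert (fun a b => σ.length b < σ.length a) p ++ as).Nodup := by
      refine ((hperm.append_right as).trans ?_).nodup_iff.2 hn
      simpa using (List.perm_middle (a := p) (l₁ := l) (l₂ := as)).symm
    obtain ⟨g1, g2, g3, g4, g5⟩ := ih (fun a ha => has a (by simp [ha])) _ (hi.sublist h1)
      (hn'.sublist (h1.append_right as))
    refine ⟨g1, g2, fun a ha => ?_, fun x hx => g4 x (h2 x (σ.full_orderedInsert B p hx)),
      fun q hq hq' x hx => ?_⟩
    · rcases List.mem_append.1 (g3 ha) with h | h
      · have := hperm.mem_iff.1 (h1.subset h)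
        simp only [List.mem_cons, List.mem_append] at this ⊢
        tauto
      · simp [h]
    · by_cases hqa : q ∈ σ.lpAccept B l p ++ as
      · exact g5 q hqa hq' x hx
      · simp only [List.mem_append, not_or] at hqa
        refine g4 x (h3 q (hperm.mem_iff.2 ?_) hqa.1 x hx)
        simp only [List.mem_cons, List.mem_append] at hq ⊢
        tauto

end ArrivalSequence

/-! ### The amortised account and its updates. -/

namespace ArrivalSequence

variable {k L : ℕ}

/-- Some packet of length `y` in `r` has been processed. -/
def Progressed (σ : ArrivalSequence k L) (r : Finset (ℕ × ℕ)) (res : ℕ × ℕ → ℕ) (y : ℕ) : Prop :=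
  ∃ a ∈ r, σ.length a = y ∧ res a < σ.work a

/-- The overall length of the packets of length at least `x`. -/
def lengthAbove (σ : ArrivalSequence k L) (s : Finset (ℕ × ℕ)) (x : ℕ) : ℕ :=
  ∑ a ∈ s with x ≤ σ.length a, σ.length a

open Classical in
/-- The bytes at level `x` of processing that was spent on packets pushed out. -/
noncomputable def wasteAbove (σ : ArrivalSequence k L) (r : Finset (ℕ × ℕ)) (res : ℕ × ℕ → ℕ)
    (u : ℕ → ℕ) (x : ℕ) : ℕ :=
  ∑ y ∈ Finset.range (L + 1) with x ≤ y + 1 ∧ ¬ σ.Progressed r res y, u y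

/-- The amortised account that compares the policy with a schedule. The policy stores `r` with
residual work `res` and has transmitted the packets `P`, of overall length `X`; the schedule stores
`q` and has transmitted `T`, of overall length `O`; `V` is the overall length of the packets
processed by the policy, counted once per cycle. Of the debt, `D` is settled, and `u y` is owed for
cycles spent on packets of length `y`. -/
structure Ledger (σ : ArrivalSequence k L) (r : Finset (ℕ × ℕ)) (res : ℕ × ℕ → ℕ)
    (q P T : Finset (ℕ × ℕ)) (X O V D : ℕ) (u : ℕ → ℕ) : Prop where
  transmitted_le : ∑ a ∈ P, σ.length a ≤ X
  opt_le : O ≤ ∑ a ∈ T ∩ P, σ.length a + k * X + D + ∑ y ∈ Finset.range (L + 1), u y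
  busy_le : V ≤ k * X + D + ∑ y ∈ Finset.range (L + 1), u y
  owed_le : ∀ y, u y ≤ y * k
  owed_progress : ∀ a ∈ r, res a < σ.work a → u (σ.length a) ≤ σ.length a * (σ.work a - res a)
  level_le : ∀ x, D + σ.lengthAbove (q \ (r ∪ P)) x + σ.wasteAbove r res u x ≤
    2 * (X + σ.lengthAbove r x)

variable (σ : ArrivalSequence k L)

theorem lengthAbove_mono {s s' : Finset (ℕ × ℕ)} {x : ℕ}
    (h : ∀ a ∈ s, x ≤ σ.length a → a ∈ s') : σ.lengthAbove s x ≤ σ.lengthAbove s' x := by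
  refine Finset.sum_le_sum_of_subset fun a ha => ?_
  simp only [Finset.mem_filter] at ha ⊢
  exact ⟨h a ha.1 ha.2, ha.2⟩

theorem lengthAbove_anti (s : Finset (ℕ × ℕ)) {x y : ℕ} (h : x ≤ y) :
    σ.lengthAbove s y ≤ σ.lengthAbove s x := by
  refine Finset.sum_le_sum_of_subset fun a ha => ?_
  simp only [Finset.mem_filter] at ha ⊢
  exact ⟨ha.1, h.trans ha.2⟩

theorem lengthAbove_eq_zero {s : Finset (ℕ × ℕ)} {x : ℕ} (h : ∀ a ∈ s, σ.length a < x) :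
    σ.lengthAbove s x = 0 := by
  rw [lengthAbove, Finset.filter_false_of_mem, Finset.sum_empty]
  exact fun a ha => not_le.2 (h a ha)

theorem lengthAbove_insert {s : Finset (ℕ × ℕ)} {p : ℕ × ℕ} (h : p ∉ s) (x : ℕ) :
    σ.lengthAbove (insert p s) x =
      (if x ≤ σ.length p then σ.length p else 0) + σ.lengthAbove s x := by
  rw [lengthAbove, Finset.filter_insert]
  split_ifs
  · rw [Finset.sum_insert (by simp [h]), lengthAbove]
  · simp [lengthAbove]

theorem wasteAbove_anti {r res u} {x y : ℕ} (h : x ≤ y) :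
    σ.wasteAbove r res u y ≤ σ.wasteAbove r res u x := by
  classical
  refine Finset.sum_le_sum_of_subset fun a ha => ?_
  simp only [Finset.mem_filter] at ha ⊢
  exact ⟨ha.1, h.trans ha.2.1, ha.2.2⟩

theorem wasteAbove_le_sum (r res u) (x : ℕ) :
    σ.wasteAbove r res u x ≤ ∑ y ∈ Finset.range (L + 1), u y := by
  classical
  exact Finset.sum_le_sum_of_subset (Finset.filter_subset _ _)

theorem wasteAbove_mono {r res r' res' u} {x : ℕ}
    (h : ∀ y, x ≤ y + 1 → σ.Progressed r res y → σ.Progressed r' res' y) :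
    σ.wasteAbove r' res' u x ≤ σ.wasteAbove r res u x := by
  classical
  refine Finset.sum_le_sum_of_subset fun a ha => ?_
  simp only [Finset.mem_filter] at ha ⊢
  exact ⟨ha.1, ha.2.1, fun h' => ha.2.2 (h a ha.2.1 h')⟩

namespace Ledger

variable {σ} {r r' q q' P T : Finset (ℕ × ℕ)} {res : ℕ × ℕ → ℕ} {X O V D : ℕ} {u : ℕ → ℕ}

theorem owed_sum_le (h : σ.Ledger r res q P T X O V D u) :
    ∑ y ∈ Finset.range (L + 1), u y ≤ k * (L + 1) ^ 2 := by
  calc ∑ y ∈ Finset.range (L + 1), u y ≤ ∑ y ∈ Finset.range (L + 1), (L + 1) * k := by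
        refine Finset.sum_le_sum fun y hy => (h.owed_le y).trans ?_
        exact Nat.mul_le_mul_right k (Finset.mem_range.1 hy).le
    _ = k * (L + 1) ^ 2 := by
        rw [Finset.sum_const, Finset.card_range, smul_eq_mul]
        ring

/-- No stored packet reaches level `L + 1`, so there the budget is `2 * X` alone. -/
theorem settled_le (h : σ.Ledger r res q P T X O V D u) (hr : ∀ a ∈ r, σ.length a ≤ L) :
    D ≤ 2 * X := by
  have := h.level_le (L + 1)
  rw [σ.lengthAbove_eq_zero (s := r) fun a ha => Nat.lt_succ_of_le (hr a ha)] at this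
  omega

theorem inter_le (h : σ.Ledger r res q P T X O V D u) : ∑ a ∈ T ∩ P, σ.length a ≤ X :=
  (Finset.sum_le_sum_of_subset Finset.inter_subset_right).trans h.transmitted_le

/-- When the policy stores no packet, everything that is owed is covered. -/
theorem opt_le_of_empty (h : σ.Ledger ∅ res q P T X O V D u) : O ≤ (k + 3) * X := by
  have h1 := h.inter_le
  have h2 := h.opt_le
  have h3 := h.level_le 0
  have h4 : σ.wasteAbove ∅ res u 0 = ∑ y ∈ Finset.range (L + 1), u y := by
    simp [wasteAbove, Progressed]
  rw [σ.lengthAbove_eq_zero (s := ∅) (by simp)] at h3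
  have h5 : (k + 3) * X = k * X + 3 * X := by ring
  omega

theorem anti_opt {O' : ℕ} (h : σ.Ledger r res q P T X O V D u) (hO : O' ≤ O) :
    σ.Ledger r res q P T X O' V D u :=
  { h with opt_le := hO.trans h.opt_le }

theorem anti_stored (h : σ.Ledger r res q P T X O V D u) (hq : q' ⊆ q) :
    σ.Ledger r res q' P T X O V D u :=
  { h with
    level_le := fun x => by
      refine le_trans ?_ (h.level_le x)
      gcongr
      exact σ.lengthAbove_mono fun a ha _ => by
        simp only [Finset.mem_sdiff] at ha ⊢
        exact ⟨hq ha.1, ha.2⟩ }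

theorem opt_mono {T' : Finset (ℕ × ℕ)} (h : σ.Ledger r res q P T X O V D u) (hT : T ⊆ T') :
    σ.Ledger r res q P T' X O V D u :=
  { h with
    opt_le := by
      refine h.opt_le.trans ?_
      gcongr }

/-- At a full level the stored bytes alone pay for everything but `D`. At any other level no
relevant packet was dropped, so neither the lost bytes nor the waste have grown. -/
theorem arrive {B : ℕ} {A : Finset (ℕ × ℕ)} (hB : 4 * L + k * (L + 1) ^ 2 ≤ B)
    (h : σ.Ledger r res q P T X O V D u) (hrL : ∀ a ∈ r, σ.length a ≤ L)
    (hA : ∀ a ∈ A, σ.work a ≤ res a)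
    (hr' : r' ⊆ r ∪ A) (hq' : q' ⊆ q ∪ A) (hqB : ∑ a ∈ q', σ.length a ≤ B)
    (hdrop : ∀ a ∈ r ∪ A, a ∉ r' → ∀ x, σ.Witnesses res a x → B < σ.lengthAbove r' x + 2 * L) :
    σ.Ledger r' res q' P T X O V D u := by
  refine ⟨h.transmitted_le, h.opt_le, h.busy_le, h.owed_le, fun a ha hp => ?_, fun x => ?_⟩
  · refine h.owed_progress a ?_ hp
    rcases Finset.mem_union.1 (hr' ha) with h' | h'
    · exact h'
    · exact absurd hp (not_lt.2 (hA a h'))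
  · by_cases hx : B < σ.lengthAbove r' x + 2 * L
    · have h1 := h.settled_le hrL
      have h2 := h.owed_sum_le
      have h3 := σ.wasteAbove_le_sum r' res u x
      have h4 : σ.lengthAbove (q' \ (r' ∪ P)) x ≤ ∑ a ∈ q', σ.length a :=
        Finset.sum_le_sum_of_subset ((Finset.filter_subset _ _).trans Finset.sdiff_subset)
      omega
    · have hkeep : ∀ a ∈ r ∪ A, σ.Witnesses res a x → a ∈ r' := fun a ha hw => by
        by_contra hn
        exact hx (hdrop a ha hn x hw)
      have h1 : σ.lengthAbove r x ≤ σ.lengthAbove r' x :=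
        σ.lengthAbove_mono fun a ha hxa => hkeep a (Finset.mem_union_left _ ha) (Or.inl hxa)
      have h2 : σ.lengthAbove (q' \ (r' ∪ P)) x ≤ σ.lengthAbove (q \ (r ∪ P)) x := by
        refine σ.lengthAbove_mono fun a ha hxa => ?_
        simp only [Finset.mem_sdiff, Finset.mem_union, not_or] at ha ⊢
        have hk : a ∉ r ∪ A := fun h' => ha.2.1 (hkeep a h' (Or.inl hxa))
        simp only [Finset.mem_union, not_or] at hk
        refine ⟨?_, hk.1, ha.2.2⟩
        rcases Finset.mem_union.1 (hq' ha.1) with h' | h'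
        · exact h'
        · exact absurd h' hk.2
      have h3 : σ.wasteAbove r' res u x ≤ σ.wasteAbove r res u x := by
        refine σ.wasteAbove_mono fun y hy => ?_
        rintro ⟨a, ha, rfl, hp⟩
        exact ⟨a, hkeep a (Finset.mem_union_left _ ha) (Or.inr ⟨hy, hp⟩), rfl, hp⟩
      have := h.level_le x
      omega

/-- When a packet of length `y` is at the head of the line, what is owed for lost packets of length
`y` can be settled. -/
theorem settle {y : ℕ} (h : σ.Ledger r res q P T X O V D u) (hy : y ≤ L)
    (hr : ∀ a ∈ r, σ.length a ≤ y) (hp : ¬ σ.Progressed r res y) :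
    σ.Ledger r res q P T X O V (D + u y) (Function.update u y 0) := by
  classical
  have hsum : ∀ s : Finset ℕ, y ∈ s →
      ∑ i ∈ s, Function.update u y 0 i + u y = ∑ i ∈ s, u i := fun s hs => by
    rw [Finset.sum_update_of_mem hs, zero_add, ← Finset.sum_sdiff (Finset.singleton_subset_iff.2 hs),
      Finset.sum_singleton]
  have hrange := hsum (Finset.range (L + 1)) (Finset.mem_range.2 (by omega))
  have hle : ∀ i, Function.update u y 0 i ≤ u i := fun i => by
    by_cases hi : i = y
    · simp [hi]
    · simp [hi]
  have hlow : ∀ x ≤ y + 1, σ.wasteAbove r res (Function.update u y 0) x + u y =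
      σ.wasteAbove r res u x := fun x hx => hsum _ (by
    simp only [Finset.mem_filter, Finset.mem_range]
    exact ⟨by omega, hx, hp⟩)
  refine ⟨h.transmitted_le, by have := h.opt_le; omega, by have := h.busy_le; omega,
    fun i => (hle i).trans (h.owed_le i), fun a ha hpa => (hle _).trans (h.owed_progress a ha hpa),
    fun x => ?_⟩
  -- Up to level `y + 1` the amount `u y` only moves from waste to `D`. Higher levels do not count
  -- `u y`, but the policy stores nothing at level `y + 1`, so the inequality there has budget `2 *
  -- X` and implies all those above it.
  rcases le_or_gt x (y + 1) with hx | hx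
  · have := h.level_le x
    have := hlow x hx
    omega
  · have h1 := h.level_le (y + 1)
    have h2 := hlow (y + 1) le_rfl
    rw [σ.lengthAbove_eq_zero (s := r) fun a ha => Nat.lt_succ_of_le (hr a ha)] at h1
    have h3 := σ.lengthAbove_anti (q \ (r ∪ P)) hx.le
    have h4 := σ.wasteAbove_anti (r := r) (res := res) (u := Function.update u y 0) hx.le
    omega

/-- The head of the line `p` is processed for one cycle. -/
theorem process {p : ℕ × ℕ} (h : σ.Ledger r res q P T X O V D u) (hpr : p ∈ r)
    (hpL : σ.length p ≤ L) (hwk : σ.work p ≤ k) (hpos : 0 < res p) (hres : res p ≤ σ.work p)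
    (hr : ∀ a ∈ r, σ.length a ≤ σ.length p)
    (hfirst : ∀ a ∈ r, a ≠ p → σ.length a = σ.length p → σ.work a ≤ res a) :
    ∃ D' u', σ.Ledger r (processPacket res p) q P T X (O + σ.length p) (V + σ.length p) D' u' := by
  classical
  obtain ⟨D', u', h', hu⟩ : ∃ D' u', σ.Ledger r res q P T X O V D' u' ∧
      u' (σ.length p) ≤ σ.length p * (σ.work p - res p) := by
    -- If `p` is already in progress, `u` at its length is bounded by the cycles spent on `p`. If
    -- `p` is fresh, no packet of its length is in progress, and the old debt is settled first.
    by_cases hp : res p < σ.work p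
    · exact ⟨D, u, h, h.owed_progress p hpr hp⟩
    · refine ⟨_, _, h.settle hpL hr ?_, by simp⟩
      rintro ⟨a, ha, hap, hlt⟩
      by_cases hne : a = p
      · exact hp (hne ▸ hlt)
      · exact absurd hlt (not_lt.2 (hfirst a ha hne hap))
  have hres' : ∀ a, a ≠ p → processPacket res p a = res a := fun a ha => by
    simp [processPacket, ha]
  have hresp : processPacket res p p = res p - 1 := by simp [processPacket]
  set v := Function.update u' (σ.length p) (u' (σ.length p) + σ.length p) with hv
  have hvp : v (σ.length p) = u' (σ.length p) + σ.length p := by simp [hv]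
  have hvn : ∀ y, y ≠ σ.length p → v y = u' y := fun y hy => by simp [hv, hy]
  have hmul : σ.length p * (σ.work p - res p) + σ.length p =
      σ.length p * (σ.work p - (res p - 1)) := by
    rw [← Nat.mul_succ]
    congr 1
    omega
  have hsum : ∑ y ∈ Finset.range (L + 1), v y =
      ∑ y ∈ Finset.range (L + 1), u' y + σ.length p := by
    have hm : σ.length p ∈ Finset.range (L + 1) := Finset.mem_range.2 (by omega)
    rw [← Finset.sum_erase_add _ _ hm, ← Finset.sum_erase_add _ u' hm, hvp, ← add_assoc]
    congr 2
    exact Finset.sum_congr rfl fun y hy => hvn y (Finset.ne_of_mem_erase hy)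
  refine ⟨D', v, h'.transmitted_le, ?_, ?_, fun y => ?_, fun a ha hlt => ?_, fun x => ?_⟩
  · have := h'.opt_le
    omega
  · have := h'.busy_le
    omega
  · by_cases hy : y = σ.length p
    · rw [hy, hvp]
      have : σ.length p * (σ.work p - (res p - 1)) ≤ σ.length p * k :=
        Nat.mul_le_mul_left _ (by omega)
      omega
    · rw [hvn y hy]
      exact h'.owed_le y
  · by_cases hap : a = p
    · subst hap
      rw [hvp, hresp]
      omega
    · rw [hres' a hap] at hlt ⊢
      by_cases hl : σ.length a = σ.length p
      · exact absurd hlt (not_lt.2 (hfirst a ha hap hl))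
      · rw [hvn _ hl]
        exact h'.owed_progress a ha hlt
  · refine le_trans ?_ (h'.level_le x)
    gcongr
    -- The new debt is not waste: `p` is now in progress and still stored.
    have hprog : σ.Progressed r (processPacket res p) (σ.length p) := ⟨p, hpr, rfl, by omega⟩
    have heq : σ.wasteAbove r (processPacket res p) v x =
        σ.wasteAbove r (processPacket res p) u' x := by
      refine Finset.sum_congr rfl fun y hy => hvn y ?_
      rintro rfl
      exact (Finset.mem_filter.1 hy).2.2 hprog
    rw [heq]
    refine σ.wasteAbove_mono fun y _ => ?_
    rintro ⟨a, ha, rfl, hlt⟩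
    refine ⟨a, ha, rfl, ?_⟩
    by_cases hap : a = p
    · subst hap
      omega
    · rwa [hres' a hap]

/-- The policy transmits a packet. -/
theorem transmit {p : ℕ × ℕ} (h : σ.Ledger r res q P T X O V D u) (hpr : p ∈ r)
    (hpL : σ.length p ≤ L) :
    ∃ u', σ.Ledger (r.erase p) res q (insert p P) T (X + σ.length p) O V D u' := by
  classical
  have hle : ∀ i, Function.update u (σ.length p) 0 i ≤ u i := fun i => by
    by_cases hi : i = σ.length p
    · simp [hi]
    · simp [hi]
  have hsum : ∑ y ∈ Finset.range (L + 1), u y ≤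
      ∑ y ∈ Finset.range (L + 1), Function.update u (σ.length p) 0 y + k * σ.length p := by
    have hm : σ.length p ∈ Finset.range (L + 1) := Finset.mem_range.2 (by omega)
    rw [← Finset.sum_erase_add _ u hm, ← Finset.sum_erase_add _ _ hm]
    simp only [Function.update_self, add_zero]
    -- The debt cleared at the length of `p` is at most `k` times that length, exactly the growth of
    -- `k * X`.
    refine add_le_add (le_of_eq ?_) ((h.owed_le _).trans (by rw [mul_comm]))
    exact Finset.sum_congr rfl fun y hy => by simp [Finset.ne_of_mem_erase hy]
  have hX : k * (X + σ.length p) = k * X + k * σ.length p := by ring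
  refine ⟨Function.update u (σ.length p) 0, ?_, ?_, ?_, fun y => (hle y).trans (h.owed_le y),
    fun a ha hlt => (hle _).trans (h.owed_progress a (Finset.mem_of_mem_erase ha) hlt), fun x => ?_⟩
  · have h1 := h.transmitted_le
    by_cases hp : p ∈ P
    · rw [Finset.insert_eq_of_mem hp]
      omega
    · rw [Finset.sum_insert hp]
      omega
  · have h1 : ∑ a ∈ T ∩ P, σ.length a ≤ ∑ a ∈ T ∩ insert p P, σ.length a :=
      Finset.sum_le_sum_of_subset
        (Finset.inter_subset_inter_left (Finset.subset_insert _ _))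
    have := h.opt_le
    omega
  · have := h.busy_le
    omega
  · have h1 : σ.lengthAbove (q \ (r.erase p ∪ insert p P)) x ≤ σ.lengthAbove (q \ (r ∪ P)) x := by
      refine σ.lengthAbove_mono fun a ha _ => ?_
      simp only [Finset.mem_sdiff, Finset.mem_union, Finset.mem_erase, Finset.mem_insert] at ha ⊢
      tauto
    have h2 : σ.wasteAbove (r.erase p) res (Function.update u (σ.length p) 0) x ≤
        σ.wasteAbove r res u x := by
      unfold wasteAbove
      rw [Finset.sum_filter, Finset.sum_filter]
      refine Finset.sum_le_sum fun y _ => ?_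
      by_cases hy : y = σ.length p
      · simp [hy]
      · rw [Function.update_of_ne hy]
        have : σ.Progressed (r.erase p) res y ↔ σ.Progressed r res y := by
          refine ⟨fun ⟨a, ha, hb⟩ => ⟨a, Finset.mem_of_mem_erase ha, hb⟩, fun ⟨a, ha, hb⟩ =>
            ⟨a, Finset.mem_erase.2 ⟨?_, ha⟩, hb⟩⟩
          rintro rfl
          exact hy hb.1.symm
        simp [this]
    have h3 := σ.lengthAbove_insert (Finset.notMem_erase p r) x
    rw [Finset.insert_erase hpr] at h3
    have h4 := h.level_le x
    split_ifs at h3 <;> omega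

/-- The schedule transmits a packet that is longer than all packets stored by the policy. -/
theorem transmit_opt {g : ℕ × ℕ} (h : σ.Ledger r res q P T X O V D u) (hg : g ∈ q) (hgT : g ∉ T)
    (hr : ∀ a ∈ r, σ.length a < σ.length g) :
    ∃ D', σ.Ledger r res (q.erase g) P (insert g T) X (O + σ.length g) V D' u := by
  classical
  by_cases hgP : g ∈ P
  · have h' := (h.anti_stored (Finset.erase_subset g q)).opt_mono (Finset.subset_insert g T)
    refine ⟨D, { h' with opt_le := ?_ }⟩
    rw [Finset.insert_inter_of_mem hgP, Finset.sum_insert (by simp [hgT])]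
    have := h.opt_le
    omega
  · have hins : insert g (q.erase g \ (r ∪ P)) = q \ (r ∪ P) := by
      ext a
      by_cases ha : a = g
      · subst ha
        simpa [hg, hgP] using fun h' => lt_irrefl _ (hr a h')
      · simp [ha]
    have hl := σ.lengthAbove_insert (s := q.erase g \ (r ∪ P)) (p := g) (by simp)
    rw [hins] at hl
    refine ⟨D + σ.length g, h.transmitted_le, ?_, ?_, h.owed_le, h.owed_progress, fun x => ?_⟩
    · have h1 : ∑ a ∈ T ∩ P, σ.length a ≤ ∑ a ∈ insert g T ∩ P, σ.length a :=
        Finset.sum_le_sum_of_subset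
          (Finset.inter_subset_inter_right (Finset.subset_insert _ _))
      have := h.opt_le
      omega
    · have := h.busy_le
      omega
    · have h1 := h.level_le x
      have h2 := hl x
      split_ifs at h2 with hx
      · omega
      -- Levels above the length of `g` follow from the level of `g` itself, where `r` contributes
      -- nothing.
      · have h3 := h.level_le (σ.length g)
        have h4 := hl (σ.length g)
        rw [if_pos le_rfl] at h4
        rw [σ.lengthAbove_eq_zero hr] at h3
        have h5 := σ.lengthAbove_anti (q.erase g \ (r ∪ P)) (not_le.1 hx).le
        have h6 := σ.wasteAbove_anti (r := r) (res := res) (u := u) (not_le.1 hx).le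
        omega

end Ledger
end ArrivalSequence

/-! ### Invariants of the runs, and the account along them. -/

namespace ArrivalSequence

variable {k L : ℕ} (σ : ArrivalSequence k L) (B : ℕ)

theorem mem_arrivals {t : ℕ} {p : ℕ × ℕ} :
    p ∈ σ.arrivals t ↔ p.1 = t ∧ p.2 < σ.count p.1 := by
  simp only [arrivals, List.mem_map, List.mem_range]
  constructor
  · rintro ⟨i, hi, rfl⟩
    exact ⟨rfl, hi⟩
  · rintro ⟨rfl, hp⟩
    exact ⟨p.2, hp, rfl⟩

theorem nodup_arrivals (t : ℕ) : (σ.arrivals t).Nodup :=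
  List.nodup_range.map fun _ _ h => (Prod.mk.inj h).2

theorem mem_remaining {s : QueueState} {p : ℕ × ℕ} :
    p ∈ s.remaining ↔ p ∈ s.buffer ∧ 0 < s.residual p := by
  simp [QueueState.remaining]

/-- What holds at the beginning of slot `t` under any policy: the stored packets have arrived before,
and no later packet has been processed. -/
structure Timely (t : ℕ) (s : QueueState) : Prop where
  nodup : s.buffer.Nodup
  arrived : ∀ p ∈ s.buffer, p.1 < t ∧ p.2 < σ.count p.1
  residual_eq : ∀ p : ℕ × ℕ, t ≤ p.1 → s.residual p = σ.work p

variable {σ B}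

theorem Timely.initial : σ.Timely 0 σ.initialState :=
  ⟨by simp [initialState], by simp [initialState], fun _ _ => rfl⟩

theorem Timely.of_mem {t : ℕ} {s : QueueState} (h : σ.Timely t s) {p : ℕ × ℕ}
    (hp : p ∈ s.remaining ++ σ.arrivals t) :
    (p.1 < t + 1 ∧ p.2 < σ.count p.1) ∧ 0 < s.residual p := by
  rcases List.mem_append.1 hp with hp | hp
  · obtain ⟨h1, h2⟩ := mem_remaining.1 hp
    obtain ⟨h3, h4⟩ := h.arrived p h1
    exact ⟨⟨by omega, h4⟩, h2⟩
  · obtain ⟨h1, h2⟩ := σ.mem_arrivals.1 hp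
    refine ⟨⟨by omega, h2⟩, ?_⟩
    rw [h.residual_eq p h1.ge]
    exact (σ.work_bounds p h2).1

theorem Timely.nodup_append {t : ℕ} {s : QueueState} (h : σ.Timely t s) :
    (s.remaining ++ σ.arrivals t).Nodup := by
  refine (h.nodup.filter _).append (σ.nodup_arrivals t) fun p hp hp' => ?_
  have h1 := (h.arrived p (mem_remaining.1 hp).1).1
  have h2 := (σ.mem_arrivals.1 hp').1
  omega

theorem Timely.step {t : ℕ} {s s' : QueueState} (h : σ.Timely t s) (hn : s'.buffer.Nodup)
    (hs : s'.buffer ⊆ s.remaining ++ σ.arrivals t)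
    (hr : s'.residual = s.residual ∨ ∃ p ∈ s'.buffer, s'.residual = processPacket s.residual p) :
    σ.Timely (t + 1) s' := by
  refine ⟨hn, fun p hp => (h.of_mem (hs hp)).1, fun p hp => ?_⟩
  rcases hr with hr | ⟨a, ha, hr⟩
  · rw [hr, h.residual_eq p (by omega)]
  · have : p ≠ a := by
      rintro rfl
      have := (h.of_mem (hs ha)).1.1
      omega
    rw [hr, processPacket, Function.update_of_ne this, h.residual_eq p (by omega)]

theorem IsSchedule.timely {S : ℕ → QueueState} (hS : σ.IsSchedule B S) (t : ℕ) :
    σ.Timely t (S t) := by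
  induction t with
  | zero => rw [hS.1]; exact Timely.initial
  | succ t ih =>
    obtain ⟨h1, h2, -, h4⟩ := hS.2 t
    exact ih.step h1 h2 h4

/-- In one slot, a schedule transmits at most one packet. -/
theorem IsSchedule.leaving_cases {S : ℕ → QueueState} (hS : σ.IsSchedule B S) (t : ℕ) :
    σ.totalLength (S (t + 1)).leaving = 0 ∨ ∃ g ∈ (S (t + 1)).buffer,
      σ.totalLength (S (t + 1)).leaving = σ.length g ∧ g ∉ (S (t + 1)).remaining := by
  obtain ⟨h1, h2, -, h4⟩ := hS.2 t
  have hpos : ∀ p ∈ (S (t + 1)).buffer, 0 < (S t).residual p := fun p hp =>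
    ((hS.timely t).of_mem (h2 hp)).2
  by_cases hl : (S (t + 1)).leaving = []
  · left
    simp [hl, totalLength]
  · right
    obtain ⟨g, hg⟩ := List.exists_mem_of_ne_nil _ hl
    have huniq : ∀ a ∈ (S (t + 1)).leaving, ∀ p, (S (t + 1)).residual =
        processPacket (S t).residual p → a = p := fun a ha p hp => by
      simp only [QueueState.leaving, List.mem_filter, decide_eq_true_eq] at ha
      by_contra hne
      rw [hp, processPacket, Function.update_of_ne hne] at ha
      exact (hpos a ha.1).ne' ha.2
    have hg' : g ∈ (S (t + 1)).buffer ∧ (S (t + 1)).residual g = 0 := by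
      simpa [QueueState.leaving] using hg
    refine ⟨g, hg'.1, ?_, fun h => (mem_remaining.1 h).2.ne' hg'.2⟩
    rcases h4 with h4 | ⟨p, -, h4⟩
    · exact absurd (h4 ▸ hg'.2) (hpos g hg'.1).ne'
    · obtain rfl := huniq g hg p h4
      have : (S (t + 1)).leaving.toFinset = {g} := by
        ext a
        simp only [List.mem_toFinset, Finset.mem_singleton]
        exact ⟨fun ha => huniq a ha g h4, fun ha => ha ▸ hg⟩
      rw [totalLength_eq_sum σ (l := (S (t + 1)).leaving) (h1.filter _), this,
        Finset.sum_singleton]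

/-- What holds for the policy in addition. -/
structure Ordered (σ : ArrivalSequence k L) (t : ℕ) (s : QueueState) : Prop
    extends σ.Timely t s where
  pairwise : s.buffer.Pairwise (σ.Precedes s.residual)
  residual_le : ∀ p, s.residual p ≤ σ.work p

theorem Ordered.foldl_spec {t : ℕ} {s : QueueState} (h : σ.Ordered t s) (B : ℕ) :
    ((σ.lpStep B t s).buffer).Nodup ∧
    ((σ.lpStep B t s).buffer).Pairwise (σ.Precedes s.residual) ∧
    (σ.lpStep B t s).buffer ⊆ s.remaining ++ σ.arrivals t ∧
    ∀ q ∈ s.remaining ++ σ.arrivals t, q ∉ (σ.lpStep B t s).buffer →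
      ∀ x, σ.Witnesses s.residual q x → σ.Full B (σ.lpStep B t s).buffer x := by
  obtain ⟨h1, h2, h3, -, h5⟩ := σ.foldl_lpAccept_spec B s.residual (σ.arrivals t)
    (fun p hp => (h.residual_eq p (σ.mem_arrivals.1 hp).1.ge).ge) s.remaining
    (h.pairwise.filter _) h.nodup_append
  exact ⟨h1, h2, h3, h5⟩

theorem lpStep_residual (t : ℕ) (s : QueueState) :
    ((σ.lpStep B t s).buffer = [] ∧ (σ.lpStep B t s).residual = s.residual) ∨
    ∃ p l, (σ.lpStep B t s).buffer = p :: l ∧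
      (σ.lpStep B t s).residual = processPacket s.residual p := by
  unfold lpStep
  cases (σ.arrivals t).foldl (σ.lpAccept B) s.remaining with
  | nil => exact Or.inl ⟨rfl, rfl⟩
  | cons p l => exact Or.inr ⟨p, l, rfl, rfl⟩

theorem Ordered.step {t : ℕ} {s : QueueState} (h : σ.Ordered t s) (B : ℕ) :
    σ.Ordered (t + 1) (σ.lpStep B t s) := by
  obtain ⟨h1, h2, h3, -⟩ := h.foldl_spec B
  rcases σ.lpStep_residual (B := B) t s with ⟨-, hr⟩ | ⟨p, l, hb, hr⟩
  · exact ⟨h.toTimely.step h1 h3 (Or.inl hr), by rwa [hr], by rw [hr]; exact h.residual_le⟩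
  · refine ⟨h.toTimely.step h1 h3 (Or.inr ⟨p, by simp [hb], hr⟩), ?_, fun a => ?_⟩
    · rw [hb] at h1 h2 ⊢
      rw [hr]
      have hpl := (List.nodup_cons.1 h1).1
      have hne : ∀ b ∈ l, processPacket s.residual p b = s.residual b := fun b hb' => by
        rw [processPacket, Function.update_of_ne]
        rintro rfl
        exact hpl hb'
      obtain ⟨g1, g2⟩ := List.pairwise_cons.1 h2
      refine List.pairwise_cons.2 ⟨fun b hb' => ?_, g2.imp_of_mem fun {a b} _ hb' hab => ?_⟩
      · simpa only [Precedes, hne b hb'] using g1 b hb'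
      · simpa only [Precedes, hne b hb'] using hab
    · have := h.residual_le a
      rw [hr, processPacket]
      by_cases ha : a = p
      · subst ha
        rw [Function.update_self]
        omega
      · rwa [Function.update_of_ne ha]

theorem ordered_lpRun (B t : ℕ) : σ.Ordered t (σ.lpRun B t) := by
  induction t with
  | zero => exact ⟨Timely.initial, List.Pairwise.nil, fun _ => le_rfl⟩
  | succ t ih => exact ih.step B

variable (σ) in
/-- The length of the first packet, and `0` if there is none. -/
def headLength : List (ℕ × ℕ) → ℕ
  | [] => 0
  | p :: _ => σ.length p

variable (σ) in
/-- The overall length of the packets that have left a run by slot `t`. -/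
def transmitted (S : ℕ → QueueState) (t : ℕ) : ℕ :=
  ∑ i ∈ Finset.range (t + 1), σ.totalLength (S i).leaving

variable (σ B) in
/-- The overall length of the packets processed by the policy before slot `t`, once per cycle. -/
def processed (t : ℕ) : ℕ :=
  ∑ i ∈ Finset.range t, σ.headLength (σ.lpRun B (i + 1)).buffer

/-- The slot of the policy after the arrivals. -/
theorem Ledger.lpStep {t : ℕ} {s : QueueState} (hs : σ.Ordered t s) {q P T : Finset (ℕ × ℕ)}
    {X O V D : ℕ} {u : ℕ → ℕ}
    (h : σ.Ledger (σ.lpStep B t s).buffer.toFinset s.residual q P T X O V D u) :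
    ∃ P' D' u', σ.Ledger (σ.lpStep B t s).remaining.toFinset (σ.lpStep B t s).residual q P' T
      (X + σ.totalLength (σ.lpStep B t s).leaving) (O + σ.headLength (σ.lpStep B t s).buffer)
      (V + σ.headLength (σ.lpStep B t s).buffer) D' u' := by
  obtain ⟨h1, h2, h3, -⟩ := hs.foldl_spec B
  rcases σ.lpStep_residual (B := B) t s with ⟨hb, hr⟩ | ⟨p, l, hb, hr⟩
  · refine ⟨P, D, u, ?_⟩
    simpa [QueueState.leaving, QueueState.remaining, hb, hr, totalLength, headLength] using h
  · simp only [QueueState.leaving, QueueState.remaining]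
    rw [hb] at h h1 h2 h3 ⊢
    rw [hr]
    obtain ⟨hpl, -⟩ := List.nodup_cons.1 h1
    obtain ⟨g1, -⟩ := List.pairwise_cons.1 h2
    obtain ⟨⟨-, hp⟩, hpos⟩ := hs.of_mem (h3 (List.mem_cons_self (a := p) (l := l)))
    have hpL := (σ.length_bounds p hp).2
    have hlpos : ∀ a ∈ l, 0 < processPacket s.residual p a := fun a ha => by
      rw [processPacket, Function.update_of_ne (by rintro rfl; exact hpl ha)]
      exact (hs.of_mem (h3 (List.mem_cons_of_mem p ha))).2
    obtain ⟨D', u', h'⟩ := h.process (p := p) (by simp) hpL (σ.work_bounds p hp).2 hpos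
      (hs.residual_le p)
      (fun a ha => by
        rcases List.mem_cons.1 (List.mem_toFinset.1 ha) with rfl | ha
        · exact le_rfl
        · exact (g1 a ha).1)
      (fun a ha hne hl => by
        rcases List.mem_cons.1 (List.mem_toFinset.1 ha) with rfl | ha
        · exact absurd rfl hne
        · exact (g1 a ha).2 hl)
    have hf1 : l.filter (fun a => decide (0 < processPacket s.residual p a)) = l :=
      List.filter_eq_self.2 fun a ha => by simpa using hlpos a ha
    have hf2 : l.filter (fun a => decide (processPacket s.residual p a = 0)) = [] :=
      List.filter_eq_nil_iff.2 fun a ha => by simpa using (hlpos a ha).ne'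
    rw [List.filter_cons, List.filter_cons, hf1, hf2]
    by_cases hz : processPacket s.residual p p = 0
    · obtain ⟨u'', h''⟩ := h'.transmit (p := p) (by simp) hpL
      refine ⟨insert p P, D', u'', ?_⟩
      have he : (p :: l).toFinset.erase p = l.toFinset := by
        rw [List.toFinset_cons, Finset.erase_insert (by simpa using hpl)]
      rw [he] at h''
      simpa [hz, totalLength, headLength] using h''
    · refine ⟨P, D', u', ?_⟩
      simpa [hz, Nat.pos_of_ne_zero hz, totalLength, headLength] using h'

/-- Only transmissions longer than the current head enter `T`. The last conjunct prevents a packet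
of `T` from returning to the schedule, so that none is counted twice. -/
theorem exists_ledger (hB : 4 * L + k * (L + 1) ^ 2 ≤ B) {S : ℕ → QueueState}
    (hS : σ.IsSchedule B S) (t : ℕ) :
    ∃ P T D u, σ.Ledger (σ.lpRun B t).remaining.toFinset (σ.lpRun B t).residual
      (S t).remaining.toFinset P T (σ.transmitted (σ.lpRun B) t) (σ.transmitted S t)
      (σ.processed B t) D u ∧ ∀ p ∈ T, p.1 < t ∧ p ∉ (S t).remaining := by
  induction t with
  | zero =>
    refine ⟨∅, ∅, 0, 0, ?_, by simp⟩
    have h0 : σ.lpRun B 0 = σ.initialState := rfl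
    rw [hS.1, h0]
    constructor <;>
      simp [transmitted, processed, hS.1, h0, initialState, QueueState.leaving,
        QueueState.remaining, totalLength, lengthAbove, wasteAbove]
  | succ t ih =>
    obtain ⟨P, T, D, u, h, hT⟩ := ih
    have hs := σ.ordered_lpRun B t
    obtain ⟨h1, h2, h3, h4⟩ := hs.foldl_spec B
    obtain ⟨o1, o2, o3, -⟩ := hS.2 t
    have harr := h.arrive (B := B) (A := (σ.arrivals t).toFinset)
      (r' := (σ.lpStep B t (σ.lpRun B t)).buffer.toFinset) (q' := (S (t + 1)).buffer.toFinset) hB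
      (fun a ha => (σ.length_bounds a
        (hs.arrived a (mem_remaining.1 (List.mem_toFinset.1 ha)).1).2).2)
      (fun a ha => (hs.residual_eq a (σ.mem_arrivals.1 (List.mem_toFinset.1 ha)).1.ge).ge)
      (fun a ha => by simpa using h3 (List.mem_toFinset.1 ha))
      (fun a ha => by simpa using o2 (List.mem_toFinset.1 ha))
      (by rwa [← totalLength_eq_sum σ o1])
      (fun a ha hn x hx => (σ.full_iff B h1 x).1
        (h4 a (by simpa using ha) (by simpa using hn) x hx))
    obtain ⟨P', D', u', h'⟩ := harr.lpStep hs
    have hX : σ.transmitted (σ.lpRun B) (t + 1) = σ.transmitted (σ.lpRun B) t +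
        σ.totalLength (σ.lpStep B t (σ.lpRun B t)).leaving := Finset.sum_range_succ _ _
    have hV : σ.processed B (t + 1) = σ.processed B t +
        σ.headLength (σ.lpStep B t (σ.lpRun B t)).buffer := Finset.sum_range_succ _ _
    have hO : σ.transmitted S (t + 1) = σ.transmitted S t +
        σ.totalLength (S (t + 1)).leaving := Finset.sum_range_succ _ _
    rw [← hX, ← hV] at h'
    have hsub : (S (t + 1)).remaining.toFinset ⊆ (S (t + 1)).buffer.toFinset := fun a ha =>
      List.mem_toFinset.2 (mem_remaining.1 (List.mem_toFinset.1 ha)).1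
    have hTS : ∀ p ∈ T, p ∉ (S (t + 1)).buffer := fun p hp hp' => by
      rcases List.mem_append.1 (o2 hp') with hm | hm
      · exact (hT p hp).2 hm
      · have h5 := (hT p hp).1
        have h6 := (σ.mem_arrivals.1 hm).1
        omega
    have hTt : ∀ p ∈ T, p.1 < t + 1 ∧ p ∉ (S (t + 1)).remaining := fun p hp =>
      ⟨(hT p hp).1.trans (Nat.lt_succ_self t), fun hm => hTS p hp (mem_remaining.1 hm).1⟩
    rcases hS.leaving_cases t with h0 | ⟨g, hg, hgl, hgr⟩
    · exact ⟨P', T, D', u', (h'.anti_stored hsub).anti_opt (by omega), hTt⟩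
    · have hTg : ∀ p ∈ insert g T, p.1 < t + 1 ∧ p ∉ (S (t + 1)).remaining := fun p hp => by
        rcases Finset.mem_insert.1 hp with rfl | hp
        · exact ⟨((hS.timely (t + 1)).arrived p hg).1, hgr⟩
        · exact hTt p hp
      -- A transmission no longer than the head is paid by the cycle just charged; for a longer one
      -- that credit is discarded and `transmit_opt` pays.
      rcases le_or_gt (σ.length g) (σ.headLength (σ.lpStep B t (σ.lpRun B t)).buffer) with hle | hlt
      · exact ⟨P', T, D', u', (h'.anti_stored hsub).anti_opt (by omega), hTt⟩
      · obtain ⟨D'', h''⟩ := (h'.anti_opt (Nat.le_add_right _ _)).transmit_opt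
          (List.mem_toFinset.2 hg) (fun hm => hTS g hm hg) (fun a ha => by
            have ha := (mem_remaining.1 (List.mem_toFinset.1 ha)).1
            refine lt_of_le_of_lt ?_ hlt
            cases hb : (σ.lpStep B t (σ.lpRun B t)).buffer with
            | nil => simp [hb] at ha
            | cons p l =>
              rw [hb] at ha h2
              rcases List.mem_cons.1 ha with rfl | ha
              · exact le_rfl
              · exact ((List.pairwise_cons.1 h2).1 a ha).1)
        refine ⟨P', insert g T, D'', u', ?_, hTg⟩
        rw [hO, hgl]
        refine h''.anti_stored fun a ha => Finset.mem_erase.2 ⟨?_, hsub ha⟩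
        rintro rfl
        exact hgr (List.mem_toFinset.1 ha)

theorem cast_transmitted_le_throughput (S : ℕ → QueueState) (t : ℕ) :
    (σ.transmitted S t : ℝ≥0∞) ≤ σ.throughput S := by
  rw [transmitted, Nat.cast_sum]
  exact ENNReal.sum_le_tsum _

end ArrivalSequence

/-! ### From finite times to the total throughput. -/

namespace ArrivalSequence

variable {k L : ℕ} {σ : ArrivalSequence k L} {B : ℕ}

theorem headLength_pos {t : ℕ} (h : (σ.lpRun B t).buffer ≠ []) :
    0 < σ.headLength (σ.lpRun B t).buffer := by
  have ha := (σ.ordered_lpRun B t).arrived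
  cases hb : (σ.lpRun B t).buffer with
  | nil => exact absurd hb h
  | cons p l => exact (σ.length_bounds p (ha p (by simp [hb])).2).1

/-- Turns perpetual processing into unbounded throughput: the unpaid part of the cycles is bounded
by a constant. -/
theorem processed_le (hB : 4 * L + k * (L + 1) ^ 2 ≤ B) {S : ℕ → QueueState}
    (hS : σ.IsSchedule B S) (t : ℕ) :
    σ.processed B t ≤ (k + 2) * σ.transmitted (σ.lpRun B) t + k * (L + 1) ^ 2 := by
  obtain ⟨P, T, D, u, h, -⟩ := exists_ledger hB hS t
  have h1 := h.busy_le
  have h2 := h.owed_sum_le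
  have h3 := h.settled_le fun a ha => (σ.length_bounds a ((σ.ordered_lpRun B t).arrived a
    (mem_remaining.1 (List.mem_toFinset.1 ha)).1).2).2
  have h4 : (k + 2) * σ.transmitted (σ.lpRun B) t =
      k * σ.transmitted (σ.lpRun B) t + 2 * σ.transmitted (σ.lpRun B) t := by ring
  omega

theorem le_processed_add {N : ℕ} (h : ∀ t ≥ N, (σ.lpRun B t).buffer ≠ []) (t : ℕ) :
    t ≤ σ.processed B t + N := by
  induction t with
  | zero => exact Nat.zero_le _
  | succ t ih =>
    have hV : σ.processed B (t + 1) = σ.processed B t +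
      σ.headLength (σ.lpRun B (t + 1)).buffer := Finset.sum_range_succ _ _
    rcases le_or_gt N (t + 1) with ht | ht
    · have := headLength_pos (h (t + 1) ht)
      omega
    · omega

theorem throughput_eq_top (hB : 4 * L + k * (L + 1) ^ 2 ≤ B) {S : ℕ → QueueState}
    (hS : σ.IsSchedule B S) {N : ℕ} (h : ∀ t ≥ N, (σ.lpRun B t).buffer ≠ []) :
    σ.throughput (σ.lpRun B) = ⊤ := by
  refine ENNReal.eq_top_of_forall_nnreal_le fun r => ?_
  obtain ⟨n, hn⟩ := exists_nat_ge r
  refine le_trans ?_ (cast_transmitted_le_throughput (σ.lpRun B)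
    ((k + 2) * n + k * (L + 1) ^ 2 + N))
  -- By this slot at least `(k + 2) * n + k * (L + 1) ^ 2` bytes have been processed, which forces
  -- `n` transmitted bytes.
  have h1 := le_processed_add h ((k + 2) * n + k * (L + 1) ^ 2 + N)
  have h2 := processed_le hB hS ((k + 2) * n + k * (L + 1) ^ 2 + N)
  have h3 : n ≤ σ.transmitted (σ.lpRun B) ((k + 2) * n + k * (L + 1) ^ 2 + N) :=
    Nat.le_of_mul_le_mul_left (c := k + 2) (by omega) (by omega)
  calc (r : ℝ≥0∞) ≤ (n : ℝ≥0∞) := by exact_mod_cast hn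
    _ ≤ _ := by exact_mod_cast h3

theorem throughput_le (hB : 4 * L + k * (L + 1) ^ 2 ≤ B) {S : ℕ → QueueState}
    (hS : σ.IsSchedule B S) : σ.throughput S ≤ (k + 3) * σ.throughput (σ.lpRun B) := by
  by_cases hbusy : ∃ N, ∀ t ≥ N, (σ.lpRun B t).buffer ≠ []
  · obtain ⟨N, hN⟩ := hbusy
    rw [throughput_eq_top hB hS hN, ENNReal.mul_top (by simp)]
    exact le_top
  · push Not at hbusy
    rw [throughput, ENNReal.tsum_eq_iSup_nat]
    refine iSup_le fun n => ?_
    obtain ⟨t, ht, hb⟩ := hbusy n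
    obtain ⟨P, T, D, u, h, -⟩ := exists_ledger hB hS t
    have hr : (σ.lpRun B t).remaining.toFinset = ∅ := by simp [QueueState.remaining, hb]
    rw [hr] at h
    calc ∑ i ∈ Finset.range n, (σ.totalLength (S i).leaving : ℝ≥0∞)
        ≤ ∑ i ∈ Finset.range (t + 1), (σ.totalLength (S i).leaving : ℝ≥0∞) :=
          -- It suffices to compare at slots when the policy's buffer is empty, since such slots
          -- occur arbitrarily late and partial sums grow.
          Finset.sum_le_sum_of_subset (Finset.range_mono (by omega))
      _ = (σ.transmitted S t : ℝ≥0∞) := by rw [transmitted, Nat.cast_sum]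
      _ ≤ ((k + 3) * σ.transmitted (σ.lpRun B) t : ℕ) := by exact_mod_cast h.opt_le_of_empty
      _ = (k + 3) * (σ.transmitted (σ.lpRun B) t : ℝ≥0∞) := by push_cast; rfl
      _ ≤ _ := by
          gcongr
          exact cast_transmitted_le_throughput _ _

end ArrivalSequence

end PacketQueue

theorem theorem7 (k L : ℕ) :
    ∃ B₀ : ℕ, ∀ B : ℕ, B₀ ≤ B →
      PacketQueue.IsCompetitive B
        (fun σ : PacketQueue.ArrivalSequence k L => σ.lpRun B) (k + 3) :=
  ⟨4 * L + k * (L + 1) ^ 2, fun _ hB _ =>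
    iSup₂_le fun _ hS => PacketQueue.ArrivalSequence.throughput_le hB hS⟩
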